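/- Consider the predicate language with countably many individual variables, countably many predicate letters of every arity, $\bot,\wedge,\vee,\to,\forall,\exists$ (no equality, no function symbols). An intuitionistic Kripke frame is a non-empty partially ordered set $\langle W,\leqslant\rangle$; it is linear if $\leqslant$ is a linear order. An augmented frame adds to it non-empty domains $D_w$ ($w\in W$) with $D_u\subseteq D_w$ whenever $u\leqslant w$, and a formula is valid on an augmented frame if, under the usual intuitionistic Kripke semantics with hereditary interpretations of predicate letters, it is true in every model on that frame, at every world $w$, under every assignment of elements of $D_w$ to its free variables. Let $\mathbf{QLC}$ be the set of formulas valid on all augmented frames based on linear Kripke frames, let $\langle\mathbb N,\leqslant\rangle\odot\mathbb N$ be the augmented frame based on $\langle\mathbb N,\leqslant\rangle$ in which every domain is $\mathbb N$, and let $\mathrm{QSIL}(\langle\mathbb N,\leqslant\rangle\odot\mathbb N)$ be the set of formulas valid on it. Theorem 4. Let $L$ be a set of formulas (in particular, any superintuitionistic predicate logic) such that $\mathbf{QLC}\subseteq L\subseteq \mathrm{QSIL}(\langle\mathbb N,\leqslant\rangle\odot\mathbb N)$, and let $L^+$ be its positive fragment, i.e. the set of formulas of $L$ in which $\bot$ does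 not occur. Then $L^+$ is $\Sigma^0_1$-hard in the language with two individual variables, a single binary predicate letter, and infinitely many unary predicate letters: for every recursively enumerable set $A\subseteq\mathbb N$ there is a computable function $f$ from $\mathbb N$ to the positive formulas of this language (only two fixed variables occur, free or bound, and only one fixed binary letter and unary letters occur) such that, for all $n$, $n\in A$ if and only if $f(n)\in L^+$. -/

import Mathlib

namespace PredKripke

/-- Formulas of the intuitionistic predicate language. Individual variables are the natural
numbers; the predicate letters of arity `n` are indexed by the natural numbers, so that
`atom n P v` is the atomic formula `P(v 0, …, v (n - 1))`, where `P` is the `P`-th predicate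
letter of arity `n`. -/
inductive Formula : Type where
  | atom (n : ℕ) (P : ℕ) (v : Fin n → ℕ) : Formula
  | bot : Formula
  | and (φ ψ : Formula) : Formula
  | or (φ ψ : Formula) : Formula
  | imp (φ ψ : Formula) : Formula
  | all (x : ℕ) (φ : Formula) : Formula
  | ex (x : ℕ) (φ : Formula) : Formula

namespace Formula

/-- The free variables of a formula. -/
def freeVars : Formula → Set ℕ
  | atom _ _ v => Set.range v
  | bot => ∅
  | and φ ψ => freeVars φ ∪ freeVars ψ
  | or φ ψ => freeVars φ ∪ freeVars ψ
  | imp φ ψ => freeVars φ ∪ freeVars ψ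
  | all x φ => freeVars φ \ {x}
  | ex x φ => freeVars φ \ {x}

/-- A formula is positive if `⊥` does not occur in it. -/
def IsPositive : Formula → Prop
  | atom _ _ _ => True
  | bot => False
  | and φ ψ => IsPositive φ ∧ IsPositive ψ
  | or φ ψ => IsPositive φ ∧ IsPositive ψ
  | imp φ ψ => IsPositive φ ∧ IsPositive ψ
  | all _ φ => IsPositive φ
  | ex _ φ => IsPositive φ

/-- The formula belongs to the language with two individual variables (the variables `0` and `1`,
no other variable occurs, free or bound), a single binary predicate letter (the one with index
`0`), all unary predicate letters, and no predicate letters of other arities. -/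
def InTwoVarLang : Formula → Prop
  | atom n P v => (n = 1 ∨ (n = 2 ∧ P = 0)) ∧ ∀ i, v i < 2
  | bot => True
  | and φ ψ => InTwoVarLang φ ∧ InTwoVarLang ψ
  | or φ ψ => InTwoVarLang φ ∧ InTwoVarLang ψ
  | imp φ ψ => InTwoVarLang φ ∧ InTwoVarLang ψ
  | all x φ => x < 2 ∧ InTwoVarLang φ
  | ex x φ => x < 2 ∧ InTwoVarLang φ

/-- A Gödel numbering of formulas. -/
def code : Formula → ℕ
  | atom n P v => Nat.pair 0 (Nat.pair n (Nat.pair P (Encodable.encode (List.ofFn v))))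
  | bot => Nat.pair 1 0
  | and φ ψ => Nat.pair 2 (Nat.pair (code φ) (code ψ))
  | or φ ψ => Nat.pair 3 (Nat.pair (code φ) (code ψ))
  | imp φ ψ => Nat.pair 4 (Nat.pair (code φ) (code ψ))
  | all x φ => Nat.pair 5 (Nat.pair x (code φ))
  | ex x φ => Nat.pair 6 (Nat.pair x (code φ))

/-- Distinct formulas have distinct Gödel numbers. -/
theorem code_injective : Function.Injective code := by
  intro φ
  induction φ with
  | atom n P v =>
    intro ψ h
    cases ψ <;> simp only [code, Nat.pair_eq_pair] at h <;> try omega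
    obtain ⟨-, rfl, rfl, h⟩ := h
    rw [List.ofFn_injective (Encodable.encode_injective h)]
  | bot =>
    intro ψ h
    cases ψ <;> simp only [code, Nat.pair_eq_pair] at h <;> first | rfl | omega
  | and φ ψ ih₁ ih₂ | or φ ψ ih₁ ih₂ | imp φ ψ ih₁ ih₂ =>
    intro χ h
    cases χ <;> simp only [code, Nat.pair_eq_pair] at h <;> try omega
    rw [ih₁ h.2.1, ih₂ h.2.2]
  | all x φ ih | ex x φ ih =>
    intro χ h
    cases χ <;> simp only [code, Nat.pair_eq_pair] at h <;> try omega
    rw [h.2.1, ih h.2.2]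

end Formula

/-- An intuitionistic Kripke frame: a non-empty set of worlds, partially ordered by the
accessibility relation. -/
structure KripkeFrame : Type 1 where
  World : Type
  [order : PartialOrder World]
  [nonempty : Nonempty World]

attribute [instance] KripkeFrame.order KripkeFrame.nonempty

/-- The accessibility relation is a linear order. -/
def KripkeFrame.IsLinear (F : KripkeFrame) : Prop :=
  ∀ u w : F.World, u ≤ w ∨ w ≤ u

/-- An intuitionistic augmented frame (with expanding domains). -/
structure AugFrame : Type 1 extends KripkeFrame where
  Indiv : Type
  dom : World → Set Indiv
  dom_nonempty : ∀ w, (dom w).Nonempty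
  dom_mono : ∀ u w, u ≤ w → dom u ⊆ dom w

/-- An interpretation of predicate letters in an augmented frame: to each world `w` and each
`n`-ary letter `P` it assigns an `n`-ary relation on the domain of `w`, subject to heredity. -/
structure Interp (F : AugFrame) where
  rel : F.World → (n : ℕ) → (P : ℕ) → Set (Fin n → F.Indiv)
  rel_dom : ∀ w n P a, a ∈ rel w n P → ∀ i, a i ∈ F.dom w
  heredity : ∀ w w' n P, w ≤ w' → rel w n P ⊆ rel w' n P

/-- Truth of a formula at a world of a Kripke model under an assignment. -/
def Forces {F : AugFrame} (I : Interp F) : F.World → (ℕ → F.Indiv) → Formula → Prop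
  | w, g, .atom n P v => (fun i => g (v i)) ∈ I.rel w n P
  | _, _, .bot => False
  | w, g, .and φ ψ => Forces I w g φ ∧ Forces I w g ψ
  | w, g, .or φ ψ => Forces I w g φ ∨ Forces I w g ψ
  | w, g, .imp φ ψ => ∀ v, w ≤ v → Forces I v g φ → Forces I v g ψ
  | w, g, .all x φ => ∀ v, w ≤ v → ∀ a ∈ F.dom v, Forces I v (Function.update g x a) φ
  | w, g, .ex x φ => ∃ a ∈ F.dom w, Forces I w (Function.update g x a) φ

/-- The formula is true in the Kripke model: at every world, under every assignment that sends
the free variables of the formula to the domain of the world. -/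
def TrueIn {F : AugFrame} (I : Interp F) (φ : Formula) : Prop :=
  ∀ (w : F.World) (g : ℕ → F.Indiv), (∀ x ∈ φ.freeVars, g x ∈ F.dom w) → Forces I w g φ

/-- The formula is valid on the augmented frame. -/
def AugFrame.Validates (F : AugFrame) (φ : Formula) : Prop :=
  ∀ I : Interp F, TrueIn I φ

/-- The superintuitionistic predicate logic of a class of augmented frames. -/
def QSIL (C : Set AugFrame) : Set Formula :=
  {φ | ∀ F ∈ C, F.Validates φ}

/-- The superintuitionistic predicate logic of a class of Kripke frames (the logic of all augmented
frames with expanding domains based on the Kripke frames of the class). -/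
def QSILe (C : Set KripkeFrame) : Set Formula :=
  QSIL {F | F.toKripkeFrame ∈ C}

/-- The logic `QLC` of linear Kripke frames. -/
def QLC : Set Formula :=
  QSILe {F | F.IsLinear}

/-- The augmented frame `⟨ℕ, ≤⟩ ⊙ ℕ`: the Kripke frame `⟨ℕ, ≤⟩` with the constant domain `ℕ`. -/
def natConst : AugFrame where
  World := ℕ
  Indiv := ℕ
  dom _ := Set.univ
  dom_nonempty _ := Set.univ_nonempty
  dom_mono _ _ _ := Set.Subset.rfl

/-- The positive fragment of a set of formulas. -/
def positiveFragment (L : Set Formula) : Set Formula :=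
  {φ | φ ∈ L ∧ φ.IsPositive}

/-- The set `X` of formulas is `Σ⁰₁`-hard in the sublanguage `K`: every recursively enumerable set
of natural numbers is many-one reducible, by a computable function all of whose values are formulas
of `K`, to membership in `X`. -/
def Sigma01HardIn (K X : Set Formula) : Prop :=
  ∀ A : ℕ → Prop, REPred A →
    ∃ f : ℕ → Formula, Computable (fun n => (f n).code) ∧
      (∀ n, f n ∈ K) ∧ ∀ n, A n ↔ f n ∈ X

end PredKripke

/-!
The proof reduces the halting problem for partial recursive functions to validity. Numbers are
represented by truth values, and the elements of a domain by tuples of numbers.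

Fix a world `v` of a model. The unary letters `reg t` attach to an element of the domain of `v`
the sets of worlds above `v` at which they hold, and these sets serve as the contents of its
registers. Equality of two contents is the equivalence `φ ↔ ψ` forced at `v`. A positive formula
that is incompatible with equality is `(φ ↔ ψ) → φ`, provided that no register is true at `v`; on
`⟨ℕ, ≤⟩` it holds whenever the two truth sets differ. The axioms for registers provide a zero tuple
and allow each register to be incremented, so every domain that satisfies them contains elements
for all tuples of numerals (`exists_numerals`). Since one element is a whole environment, two
individual variables suffice to express any Horn clause over `ℕ` with at most eight variables: one
variable ranges over the environments, the other over the tuples in which a fact is recorded.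

Thus a Horn program `P` and a goal `A` are turned into a positive formula `ofProgram P A` in unary
letters and two variables. If the goal is derivable, the formula is valid on every augmented frame,
because the derivation can be repeated inside any model that forces the axioms
(`validates_ofProgram`). If it is not, the formula is refuted on `⟨ℕ, ≤⟩ ⊙ ℕ` by the model in which
a register with content `m` becomes true at the world `m + 1` and the derivable facts are true
everywhere (`derives_of_natConst_validates`). So `ofProgram P A` belongs to a given set between
`QLC` and the logic of `⟨ℕ, ≤⟩ ⊙ ℕ` if and only if `A` is derivable from `P`.

Finally, the graph of every partial recursive function is a relation of the least model of a Horn program, by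
recursion on its code (`derives_graph`, `codeClauses_holdsIn`), and the input `n` is supplied by
`n` further clauses, each of which shifts the domain of the function by one.
-/

namespace PredKripke

/-! ### Horn programs over the natural numbers -/

/-- A term of a Horn clause over the variables `x₀, …, x₇`: `none` is the constant `0`,
`some (i, false)` is the variable `xᵢ`, and `some (i, true)` is `xᵢ + 1`. -/
abbrev Term := Option (Fin 8 × Bool)

/-- The term `xᵢ`. -/
abbrev Term.var (i : Fin 8) : Term := some (i, false)

/-- The term `xᵢ + 1`. -/
abbrev Term.succ (i : Fin 8) : Term := some (i, true)

/-- The value of a term in an environment. -/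
def Term.val (e : Fin 8 → ℕ) : Term → ℕ
  | none => 0
  | some (i, false) => e i
  | some (i, true) => e i + 1

/-- An atom of a Horn clause: the name of a quaternary relation on `ℕ` with four terms as
arguments. Relations of smaller arity are padded with zeros. -/
abbrev HornAtom (ν : Type) := ν × (Fin 4 → Term)

/-- The tuple of values of the arguments of an atom. -/
def HornAtom.vals {ν : Type} (e : Fin 8 → ℕ) (A : HornAtom ν) : Fin 4 → ℕ :=
  fun k => Term.val e (A.2 k)

/-- A Horn clause, universally quantified over the environments. -/
structure HornClause (ν : Type) where
  head : HornAtom ν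
  body : List (HornAtom ν)

/-- The least model of a Horn program: `Derives P R a` says that the fact `R(a)` follows. -/
inductive Derives {ν : Type} (P : List (HornClause ν)) : ν → (Fin 4 → ℕ) → Prop
  | step (C : HornClause ν) (hC : C ∈ P) (e : Fin 8 → ℕ)
      (h : ∀ A ∈ C.body, Derives P A.1 (HornAtom.vals e A)) :
      Derives P C.head.1 (HornAtom.vals e C.head)

/-! ### Formulas encoding Horn programs -/

namespace Formula

/-- The unary letter that stores the value of the term `t`, applied to the variable `x`. -/
def reg (t : Term) (x : ℕ) : Formula :=
  atom 1 (2 * Encodable.encode t) fun _ => x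

/-- The unary letter expressing that the atom `A` holds in the environment `x`. -/
def holds {ν : Type} [Encodable ν] (A : HornAtom ν) (x : ℕ) : Formula :=
  atom 1 (2 * Encodable.encode A + 1) fun _ => x

/-- The equivalence of two formulas. -/
def iff (φ ψ : Formula) : Formula := and (imp φ ψ) (imp ψ φ)

/-- A positive way of saying that `φ` and `ψ` become true at different worlds. If they are
equivalent at a world then `neq φ ψ` makes `φ` true there; conversely, if their truth sets in
`⟨ℕ, ≤⟩` are distinct, then `φ ↔ ψ` holds only where both are true already. -/
def neq (φ ψ : Formula) : Formula := imp (iff φ ψ) φ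

/-- The conjunction of a list of formulas; the empty conjunction is a positive tautology. -/
def conj : List Formula → Formula
  | [] => imp (reg none 0) (reg none 0)
  | φ :: l => and φ (conj l)

/-- The disjunction of `φ` and the formulas of a list. -/
def disj (φ : Formula) : List Formula → Formula
  | [] => φ
  | ψ :: l => or ψ (disj φ l)

/-- The letter of the constant `0` has the same truth value on all elements, some environment
stores `0` in all registers, the successor is a function of the value of a register, and every
register of every environment can be incremented. -/
def registerAxioms : Formula :=
  conj
    [all 0 (all 1 (iff (reg none 0) (reg none 1))),
      ex 0 (conj ((List.finRange 8).map fun i => iff (reg (Term.var i) 0) (reg none 0))),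
      all 0 (all 1 (conj ((List.finRange 8 ×ˢ List.finRange 8).map fun p =>
        or (neq (reg (Term.var p.1) 0) (reg (Term.var p.2) 1))
          (iff (reg (Term.succ p.1) 0) (reg (Term.succ p.2) 1))))),
      conj ((List.finRange 8).map fun i => all 0 (ex 1 (conj ((List.finRange 8).map fun j =>
        iff (reg (Term.var j) 1) (reg (if j = i then Term.succ i else Term.var j) 0)))))]

/-- The variables `x₀, x₁, x₂, x₃` as arguments. -/
def stdArgs : Fin 4 → Term := fun k => Term.var (Fin.castLE (by decide) k)

section
variable {ν : Type} [Encodable ν]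

/-- The truth of `R(t₀, …, t₃)` in an environment depends only on the values of the terms: it
amounts to the truth of `R(x₀, …, x₃)` in any environment that stores these values in its first
four registers. -/
def transfer (A : HornAtom ν) : Formula :=
  all 0 (all 1 (disj (iff (holds A 0) (holds (A.1, stdArgs) 1))
    ((List.finRange 4).map fun k => neq (reg (A.2 k) 0) (reg (stdArgs k) 1))))

/-- The clause itself, as a chain of implications between atoms in one environment. -/
def clauseRule (C : HornClause ν) : Formula :=
  all 0 (C.body.foldr (fun A φ => imp (holds A 0) φ) (holds C.head 0))

/-- A clause together with the transfer formulas of its atoms. -/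
def ofClause (C : HornClause ν) : Formula :=
  and (conj ((C.head :: C.body).map transfer)) (clauseRule C)

/-- Some environment satisfies the goal, or some register is already true. The second
alternative excludes models in which `neq` is not faithful. -/
def goal (A : HornAtom ν) : Formula :=
  disj (ex 0 (holds A 0)) ((List.finRange 8).map fun i => ex 0 (reg (Term.var i) 0))

/-- The formula saying that the program `P` yields the goal `A`. -/
def ofProgram (P : List (HornClause ν)) (A : HornAtom ν) : Formula :=
  imp (and registerAxioms (and (transfer A) (conj (P.map ofClause)))) (goal A)

end

end Formula

open Formula

/-! ### Forcing of the encoding formulas -/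

section
variable {F : AugFrame} (I : Interp F)

theorem forces_conj {w : F.World} {g : ℕ → F.Indiv} {l : List Formula} :
    Forces I w g (conj l) ↔ ∀ φ ∈ l, Forces I w g φ := by
  induction l with
  | nil => simp [conj, Forces]
  | cons φ l ih => simp [conj, Forces, ih]

theorem forces_disj {w : F.World} {g : ℕ → F.Indiv} {φ : Formula} {l : List Formula} :
    Forces I w g (disj φ l) ↔ Forces I w g φ ∨ ∃ ψ ∈ l, Forces I w g ψ := by
  induction l with
  | nil => simp [disj]
  | cons ψ l ih => simp only [disj, Forces, ih, List.exists_mem_cons_iff]; tauto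

/-- The truth value, seen from the world `v`, of the register `t` of the element `a`. -/
def regVal (v : F.World) (t : Term) (a : F.Indiv) : Set F.World :=
  {w | v ≤ w ∧ (fun _ => a) ∈ I.rel w 1 (2 * Encodable.encode t)}

theorem mem_regVal_self {v : F.World} {t : Term} {g : ℕ → F.Indiv} {x : ℕ} :
    v ∈ regVal I v t (g x) ↔ Forces I v g (reg t x) := by
  simp [regVal, reg, Forces]

theorem forces_iff_reg {v : F.World} {t t' : Term} {g : ℕ → F.Indiv} {x y : ℕ} :
    Forces I v g (iff (reg t x) (reg t' y)) ↔ regVal I v t (g x) = regVal I v t' (g y) := by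
  simp only [Formula.iff, reg, Forces, regVal, Set.ext_iff, Set.mem_ofPred_eq]
  constructor
  · rintro ⟨h₁, h₂⟩ w
    exact ⟨fun h => ⟨h.1, h₁ w h.1 h.2⟩, fun h => ⟨h.1, h₂ w h.1 h.2⟩⟩
  · exact fun h => ⟨fun w hw h' => ((h w).1 ⟨hw, h'⟩).2, fun w hw h' => ((h w).2 ⟨hw, h'⟩).2⟩

theorem forces_neq_reg {v : F.World} {t t' : Term} {g : ℕ → F.Indiv} {x y : ℕ}
    (h : Forces I v g (neq (reg t x) (reg t' y)))
    (h' : regVal I v t (g x) = regVal I v t' (g y)) : v ∈ regVal I v t' (g y) := by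
  rw [← h', mem_regVal_self]
  exact h v le_rfl ((forces_iff_reg I).2 h')

end

/-! ### Derivable goals give valid formulas -/

/-- If the successor value of a register depends only on its value, and registers can be
incremented one at a time starting from a tuple of zeros, then all tuples of numerals are stored. -/
theorem exists_numerals {D V : Type*} {K : ℕ} (z : V) (r s : Fin K → D → V)
    (h0 : ∃ x, ∀ i, r i x = z)
    (hfun : ∀ i j x y, r i x = r j y → s i x = s j y)
    (hsucc : ∀ i x, ∃ y, ∀ j, r j y = if j = i then s i x else r j x) :
    ∃ num : ℕ → V, num 0 = z ∧ (∀ i x m, r i x = num m → s i x = num (m + 1)) ∧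
      ∀ e : Fin K → ℕ, ∃ x, ∀ i, r i x = num (e i) := by
  classical
  -- The successor as a function of values; off the range of the registers it is irrelevant.
  let S : V → V := fun u =>
    if h : ∃ p : Fin K × D, r p.1 p.2 = u then s h.choose.1 h.choose.2 else u
  have hS : ∀ i x, S (r i x) = s i x := by
    intro i x
    have h : ∃ p : Fin K × D, r p.1 p.2 = r i x := ⟨(i, x), rfl⟩
    simp only [S, dif_pos h]
    exact hfun _ _ _ _ h.choose_spec
  refine ⟨fun m => S^[m] z, rfl, ?_, ?_⟩
  · intro i x m h
    rw [← hS, h]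
    exact (Function.iterate_succ_apply' S m z).symm
  · suffices ∀ (n : ℕ) (e : Fin K → ℕ), ∑ i, e i = n → ∃ x, ∀ i, r i x = S^[e i] z from
      fun e => this _ e rfl
    intro n
    induction n with
    | zero =>
      intro e he
      obtain ⟨x, hx⟩ := h0
      refine ⟨x, fun i => ?_⟩
      rw [Finset.sum_eq_zero_iff.1 he i (Finset.mem_univ i), hx]
      rfl
    | succ n ih =>
      intro e he
      obtain ⟨i, -, hi⟩ : ∃ i ∈ Finset.univ, e i ≠ 0 := by
        by_contra! h
        rw [Finset.sum_eq_zero h] at he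
        omega
      obtain ⟨x, hx⟩ := ih (Function.update e i (e i - 1)) (by
        rw [Finset.sum_update_of_mem (Finset.mem_univ i)]
        rw [← Finset.add_sum_erase _ _ (Finset.mem_univ i), ← Finset.sdiff_singleton_eq_erase] at he
        omega)
      obtain ⟨y, hy⟩ := hsucc i x
      refine ⟨y, fun j => ?_⟩
      rw [hy]
      split_ifs with hj
      · subst hj
        rw [← hS, hx, Function.update_self, ← Function.iterate_succ_apply' S]
        congr 2
        omega
      · rw [hx, Function.update_of_ne hj]

section
variable {ν : Type} [Encodable ν] {P : List (HornClause ν)} {A : HornAtom ν}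

theorem forces_clauseBody {F : AugFrame} {I : Interp F} {v : F.World} {g : ℕ → F.Indiv}
    {l : List (HornAtom ν)} {B : HornAtom ν}
    (h : Forces I v g (l.foldr (fun A φ => imp (holds A 0) φ) (holds B 0)))
    (hl : ∀ A ∈ l, Forces I v g (holds A 0)) : Forces I v g (holds B 0) := by
  induction l with
  | nil => exact h
  | cons A l ih =>
    exact ih (h v le_rfl (hl A List.mem_cons_self)) fun B hB => hl B (List.mem_cons_of_mem _ hB)

/-- At a world that forces the axioms but not the goal, elements with equal truth values of
registers satisfy the same atoms, so a derivation can be followed inside the model. -/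
theorem validates_ofProgram (hA : ∃ e, Derives P A.1 (HornAtom.vals e A)) (F : AugFrame) :
    F.Validates (ofProgram P A) := by
  intro I w g _ v hwv hax
  obtain ⟨hreg, htr, hP⟩ := hax
  by_contra hgoal
  rw [goal, forces_disj, not_or] at hgoal
  obtain ⟨hgoal, hpos⟩ := hgoal
  -- No register of an element of the domain of `v` is true at `v`.
  have hpos : ∀ i, ∀ a ∈ F.dom v, v ∉ regVal I v (Term.var i) a := by
    intro i a ha h
    refine hpos ⟨_, List.mem_map.2 ⟨i, List.mem_finRange i, rfl⟩, a, ha, ?_⟩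
    rw [← mem_regVal_self]
    simpa using h
  -- Hence the formulas `transfer B` can be applied to equal values.
  have htransfer : ∀ B : HornAtom ν, Forces I v g (transfer B) → ∀ a ∈ F.dom v, ∀ b ∈ F.dom v,
      (∀ k, regVal I v (B.2 k) a = regVal I v (stdArgs k) b) →
      ((∀ x g, g x = a → Forces I v g (holds B x)) ↔
        ∀ x g, g x = b → Forces I v g (holds (B.1, stdArgs) x)) := by
    intro B hB a ha b hb hab
    have h := hB v le_rfl a ha v le_rfl b hb
    rw [forces_disj] at h
    rcases h with h | ⟨ψ, hψ, h⟩
    · constructor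
      · intro h1 x g' hx
        have h2 := h.1 v le_rfl (h1 0 _ (by simp))
        simpa [holds, Forces, hx] using h2
      · intro h1 x g' hx
        have h2 := h.2 v le_rfl (h1 1 _ (by simp))
        simpa [holds, Forces, hx] using h2
    · obtain ⟨k, -, rfl⟩ := List.mem_map.1 hψ
      have := forces_neq_reg I h (by simpa using hab k)
      rw [Function.update_self] at this
      exact absurd this (hpos _ b hb)
  simp only [registerAxioms, forces_conj, List.forall_mem_cons] at hreg
  obtain ⟨hz, hinit, hfun, hsucc, -⟩ := hreg
  have hz : ∀ a ∈ F.dom v, ∀ b ∈ F.dom v, regVal I v none a = regVal I v none b := by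
    intro a ha b hb
    have h := hz v le_rfl a ha v le_rfl b hb
    simpa [forces_iff_reg] using h
  obtain ⟨a₀, ha₀, hinit⟩ := hinit
  obtain ⟨num, hnum0, hnums, hnum⟩ := exists_numerals (D := F.dom v) (regVal I v none a₀)
    (fun i a => regVal I v (Term.var i) a) (fun i a => regVal I v (Term.succ i) a)
    (by
      refine ⟨⟨a₀, ha₀⟩, fun i => ?_⟩
      have := (forces_conj I).1 hinit _ (List.mem_map.2 ⟨i, List.mem_finRange i, rfl⟩)
      simpa [forces_iff_reg] using this)
    (by
      rintro i j ⟨a, ha⟩ ⟨b, hb⟩ hab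
      have := (forces_conj I).1 (hfun v le_rfl a ha v le_rfl b hb) _
        (List.mem_map.2 ⟨(i, j), by simp, rfl⟩)
      rcases this with h | h
      · exact absurd (by simpa using forces_neq_reg I h (by simpa using hab)) (hpos j b hb)
      · simpa [forces_iff_reg] using h)
    (by
      rintro i ⟨a, ha⟩
      have := hsucc _ (List.mem_map.2 ⟨i, List.mem_finRange i, rfl⟩)
      obtain ⟨b, hb, this⟩ := this v le_rfl a ha
      refine ⟨⟨b, hb⟩, fun j => ?_⟩
      have := (forces_conj I).1 this _ (List.mem_map.2 ⟨j, List.mem_finRange j, rfl⟩)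
      rw [forces_iff_reg] at this
      split_ifs with h <;> simpa [h] using this)
  -- The element storing the environment `e` gives every term its value.
  have henv : ∀ e : Fin 8 → ℕ, ∃ a ∈ F.dom v, ∀ t, regVal I v t a = num (Term.val e t) := by
    intro e
    obtain ⟨⟨a, ha⟩, h⟩ := hnum e
    refine ⟨a, ha, fun t => ?_⟩
    rcases t with _ | ⟨i, _ | _⟩
    · rw [Term.val, hnum0]
      exact hz a ha a₀ ha₀
    · exact h i
    · exact hnums i ⟨a, ha⟩ _ (h i)
  have hstd : ∀ (e : Fin 8 → ℕ) (B : HornAtom ν), ∃ b ∈ F.dom v,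
      ∀ k, regVal I v (stdArgs k) b = num (HornAtom.vals e B k) := by
    intro e B
    obtain ⟨b, hb, h⟩ := henv fun i => if hi : (i : ℕ) < 4 then HornAtom.vals e B ⟨i, hi⟩ else 0
    refine ⟨b, hb, fun k => ?_⟩
    rw [h]
    simp [stdArgs, Term.val]
  have hder : ∀ R args, Derives P R args → ∀ b ∈ F.dom v,
      (∀ k, regVal I v (stdArgs k) b = num (args k)) →
      ∀ x g, g x = b → Forces I v g (holds (R, stdArgs) x) := by
    intro R args h
    induction h with
    | step C hC e _ ih =>
      intro b hb hb'
      obtain ⟨a, ha, hae⟩ := henv e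
      obtain ⟨htrC, hrule⟩ := (forces_conj I).1 hP _ (List.mem_map.2 ⟨C, hC, rfl⟩)
      have htrC : ∀ B ∈ C.head :: C.body, Forces I v g (transfer B) := fun B hB =>
        (forces_conj I).1 htrC _ (List.mem_map.2 ⟨B, hB, rfl⟩)
      refine (htransfer C.head (htrC _ List.mem_cons_self) a ha b hb
        fun k => by rw [hae, hb']; rfl).1 ?_
      have := forces_clauseBody (hrule v le_rfl a ha) fun B hB => by
        obtain ⟨b', hb', hbB⟩ := hstd e B
        exact (htransfer B (htrC _ (List.mem_cons_of_mem _ hB)) a ha b' hb'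
          fun k => by rw [hae, hbB]; rfl).2 (ih B hB b' hb' hbB) 0 _ (by simp)
      intro x g' hx
      simpa [holds, Forces, hx] using this
  obtain ⟨e, he⟩ := hA
  obtain ⟨a, ha, hae⟩ := henv e
  obtain ⟨b, hb, hbA⟩ := hstd e A
  exact hgoal ⟨a, ha, (htransfer A htr a ha b hb fun k => by rw [hae, hbA]; rfl).2
    (hder _ _ he b hb hbA) 0 _ (by simp)⟩

/-! ### Underivable goals are refuted over the natural numbers -/

/-- The model on `⟨ℕ, ≤⟩ ⊙ ℕ` in which the element `a` stores the environment `ρ a`: a register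
with value `m` becomes true at the world `m + 1`, and derivable facts are true everywhere. -/
def natModel (P : List (HornClause ν)) (ρ : natConst.Indiv → Fin 8 → ℕ) : Interp natConst where
  rel w n Q := {a | (∃ t : Term, Q = 2 * Encodable.encode t ∧ ∀ i, Term.val (ρ (a i)) t < (w : ℕ)) ∨
    ∃ A : HornAtom ν, Q = 2 * Encodable.encode A + 1 ∧
      ∀ i, Derives P A.1 (HornAtom.vals (ρ (a i)) A)}
  rel_dom _ _ _ _ _ _ := Set.mem_univ _
  heredity := by
    rintro w w' n Q h a (⟨t, hQ, ht⟩ | h')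
    · exact .inl ⟨t, hQ, fun i => (ht i).trans_le h⟩
    · exact .inr h'

variable {ρ : natConst.Indiv → Fin 8 → ℕ} {w : natConst.World} {g : ℕ → natConst.Indiv} {x y : ℕ}

theorem natModel_reg {t : Term} :
    Forces (natModel P ρ) w g (reg t x) ↔ Term.val (ρ (g x)) t < (w : ℕ) := by
  constructor
  · rintro (⟨t', ht, h⟩ | ⟨A, hA, -⟩)
    · obtain rfl : t = t' := Encodable.encode_injective (by omega)
      exact h 0
    · omega
  · exact fun h => .inl ⟨t, rfl, fun _ => h⟩

theorem natModel_holds {B : HornAtom ν} :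
    Forces (natModel P ρ) w g (holds B x) ↔ Derives P B.1 (HornAtom.vals (ρ (g x)) B) := by
  constructor
  · rintro (⟨t', ht, h⟩ | ⟨A, hA, h⟩)
    · omega
    · obtain rfl : B = A := Encodable.encode_injective (by omega)
      exact h 0
  · exact fun h => .inr ⟨B, rfl, fun _ => h⟩

theorem natModel_iff {t t' : Term} (h : Term.val (ρ (g x)) t = Term.val (ρ (g y)) t') :
    Forces (natModel P ρ) w g (iff (reg t x) (reg t' y)) :=
  ⟨fun _ _ h' => natModel_reg.2 (h ▸ natModel_reg.1 h'),
    fun _ _ h' => natModel_reg.2 (h ▸ natModel_reg.1 h')⟩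

/-- If the contents differ, the equivalence is forced only after both registers have become true. -/
theorem natModel_neq {t t' : Term} (h : Term.val (ρ (g x)) t ≠ Term.val (ρ (g y)) t') :
    Forces (natModel P ρ) w g (neq (reg t x) (reg t' y)) := by
  rintro (u : ℕ) - ⟨h₁, h₂⟩
  refine natModel_reg.2 ?_
  by_contra! hu
  rcases lt_or_gt_of_ne h with h | h
  · have h3 := natModel_reg.1 (h₁ (Term.val (ρ (g x)) t + 1) (Nat.le_succ_of_le hu)
      (natModel_reg.2 (Nat.lt_succ_self _)))
    omega
  · exact absurd (natModel_reg.1 (h₂ (Term.val (ρ (g x)) t) hu (natModel_reg.2 h))) (lt_irrefl _)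

theorem natModel_transfer {B : HornAtom ν} : Forces (natModel P ρ) w g (transfer B) := by
  rintro u - a - u' - b -
  rw [forces_disj]
  by_cases h : ∀ k, Term.val (ρ a) (B.2 k) = Term.val (ρ b) (stdArgs k)
  · have h' : HornAtom.vals (ρ a) B = HornAtom.vals (ρ b) (B.1, stdArgs) := funext h
    refine .inl ⟨fun _ _ h₁ => ?_, fun _ _ h₁ => ?_⟩
    · refine natModel_holds.2 ?_
      have h₂ := natModel_holds.1 h₁
      simp only [Function.update_self, Function.update_of_ne zero_ne_one] at h₂ ⊢
      rwa [← h']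
    · refine natModel_holds.2 ?_
      have h₂ := natModel_holds.1 h₁
      simp only [Function.update_self, Function.update_of_ne zero_ne_one] at h₂ ⊢
      rwa [h']
  · push Not at h
    obtain ⟨k, hk⟩ := h
    exact .inr ⟨_, List.mem_map.2 ⟨k, List.mem_finRange k, rfl⟩, natModel_neq (by simpa using hk)⟩

theorem natModel_clauseRule {C : HornClause ν} (hC : C ∈ P) :
    Forces (natModel P ρ) w g (clauseRule C) := by
  suffices H : ∀ (l : List (HornAtom ν)) (u : natConst.World) (g : ℕ → natConst.Indiv),
      ((∀ A ∈ l, Derives P A.1 (HornAtom.vals (ρ (g 0)) A)) →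
        Derives P C.head.1 (HornAtom.vals (ρ (g 0)) C.head)) →
      Forces (natModel P ρ) u g (l.foldr (fun A φ => imp (holds A 0) φ) (holds C.head 0)) from
    fun u _ a _ => H C.body u _ fun h => .step C hC _ h
  intro l
  induction l with
  | nil => exact fun u g h => natModel_holds.2 (h (by simp))
  | cons A l ih =>
    intro u g h u' _ hA
    exact ih u' g fun hl => h (List.forall_mem_cons.2 ⟨natModel_holds.1 hA, hl⟩)

theorem natModel_registerAxioms (hρ : Function.Surjective ρ) :
    Forces (natModel P ρ) w g registerAxioms := by
  simp only [registerAxioms, forces_conj, List.forall_mem_cons, List.forall_mem_map]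
  refine ⟨?_, ?_, ?_, ?_, by simp⟩
  · rintro u - a - u' - b -
    exact natModel_iff rfl
  · obtain ⟨a, ha⟩ := hρ 0
    refine ⟨a, trivial, ?_⟩
    simp only [forces_conj, List.forall_mem_map]
    intro i _
    refine natModel_iff ?_
    simp [ha, Term.val]
  · rintro u - a - u' - b -
    simp only [forces_conj, List.forall_mem_map]
    intro p _
    by_cases h : ρ a p.1 = ρ b p.2
    · refine .inr (natModel_iff ?_)
      simpa [Term.val] using h
    · refine .inl (natModel_neq ?_)
      simpa [Term.val] using h
  · rintro i - u - a -
    obtain ⟨b, hb⟩ := hρ (Function.update (ρ a) i (ρ a i + 1))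
    refine ⟨b, trivial, ?_⟩
    simp only [forces_conj, List.forall_mem_map]
    intro j _
    refine natModel_iff ?_
    simp only [Function.update_self, Function.update_of_ne zero_ne_one]
    split_ifs with h
    · simp [hb, h, Term.val]
    · simp [hb, h, Term.val]

/-- An underivable goal is not forced at the world `0` of `natModel`, where all axioms are. -/
theorem derives_of_natConst_validates (h : natConst.Validates (ofProgram P A)) :
    ∃ e, Derives P A.1 (HornAtom.vals e A) := by
  obtain ⟨ρ, hρ⟩ := exists_surjective_nat (Fin 8 → ℕ)
  by_contra hA
  have hgoal := h (natModel P ρ) (0 : ℕ) (fun _ => (0 : ℕ)) (fun _ _ => trivial) (0 : ℕ) le_rfl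
    ⟨natModel_registerAxioms hρ, natModel_transfer, (forces_conj _).2 (by
      simp only [List.forall_mem_map]
      refine fun C hC => ⟨(forces_conj _).2 ?_, natModel_clauseRule hC⟩
      simp only [List.forall_mem_map]
      exact fun _ _ => natModel_transfer)⟩
  rcases (forces_disj _).1 hgoal with ⟨a, -, ha⟩ | ⟨ψ, hψ, hpos⟩
  · exact hA ⟨_, natModel_holds.1 ha⟩
  · obtain ⟨i, -, rfl⟩ := List.mem_map.1 hψ
    obtain ⟨a, -, ha⟩ := hpos
    exact absurd (natModel_reg.1 ha) (Nat.not_lt_zero _)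

/-! ### The encoding formulas are positive and use two variables -/

/-- Positive formulas of the two-variable language. -/
def Positive₂ (φ : Formula) : Prop := φ.IsPositive ∧ φ.InTwoVarLang

theorem positive₂_conj {l : List Formula} (h : ∀ φ ∈ l, Positive₂ φ) : Positive₂ (conj l) := by
  induction l with
  | nil => simp [conj, Positive₂, IsPositive, InTwoVarLang, reg]
  | cons φ l ih =>
    obtain ⟨h₁, h₂⟩ := List.forall_mem_cons.1 h
    exact ⟨⟨h₁.1, (ih h₂).1⟩, h₁.2, (ih h₂).2⟩

theorem positive₂_disj {φ : Formula} {l : List Formula} (hφ : Positive₂ φ)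
    (h : ∀ ψ ∈ l, Positive₂ ψ) : Positive₂ (disj φ l) := by
  induction l with
  | nil => exact hφ
  | cons ψ l ih =>
    obtain ⟨h₁, h₂⟩ := List.forall_mem_cons.1 h
    exact ⟨⟨h₁.1, (ih h₂).1⟩, h₁.2, (ih h₂).2⟩

theorem positive₂_all {φ : Formula} {x : ℕ} (hx : x < 2) (h : Positive₂ φ) :
    Positive₂ (all x φ) := ⟨h.1, hx, h.2⟩

theorem positive₂_ex {φ : Formula} {x : ℕ} (hx : x < 2) (h : Positive₂ φ) :
    Positive₂ (ex x φ) := ⟨h.1, hx, h.2⟩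

theorem positive₂_reg {t : Term} {x : ℕ} (hx : x < 2) : Positive₂ (reg t x) :=
  ⟨trivial, .inl rfl, fun _ => hx⟩

theorem positive₂_holds {B : HornAtom ν} {x : ℕ} (hx : x < 2) : Positive₂ (holds B x) :=
  ⟨trivial, .inl rfl, fun _ => hx⟩

theorem positive₂_imp {φ ψ : Formula} (h₁ : Positive₂ φ) (h₂ : Positive₂ ψ) :
    Positive₂ (imp φ ψ) := ⟨⟨h₁.1, h₂.1⟩, h₁.2, h₂.2⟩

theorem positive₂_and {φ ψ : Formula} (h₁ : Positive₂ φ) (h₂ : Positive₂ ψ) :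
    Positive₂ (and φ ψ) := ⟨⟨h₁.1, h₂.1⟩, h₁.2, h₂.2⟩

theorem positive₂_or {φ ψ : Formula} (h₁ : Positive₂ φ) (h₂ : Positive₂ ψ) :
    Positive₂ (or φ ψ) := ⟨⟨h₁.1, h₂.1⟩, h₁.2, h₂.2⟩

theorem positive₂_iff {φ ψ : Formula} (h₁ : Positive₂ φ) (h₂ : Positive₂ ψ) :
    Positive₂ (iff φ ψ) := positive₂_and (positive₂_imp h₁ h₂) (positive₂_imp h₂ h₁)

theorem positive₂_neq {φ ψ : Formula} (h₁ : Positive₂ φ) (h₂ : Positive₂ ψ) :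
    Positive₂ (neq φ ψ) := positive₂_imp (positive₂_iff h₁ h₂) h₁

theorem positive₂_registerAxioms : Positive₂ registerAxioms := by
  have h0 : ∀ t, Positive₂ (reg t 0) := fun _ => positive₂_reg (by decide)
  have h1 : ∀ t, Positive₂ (reg t 1) := fun _ => positive₂_reg (by decide)
  refine positive₂_conj ?_
  simp only [List.forall_mem_cons]
  refine ⟨?_, ?_, ?_, ?_, by simp⟩
  · exact positive₂_all (by decide) (positive₂_all (by decide) (positive₂_iff (h0 _) (h1 _)))
  · refine positive₂_ex (by decide) (positive₂_conj (List.forall_mem_map.2 fun i _ => ?_))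
    exact positive₂_iff (h0 _) (h0 _)
  · refine positive₂_all (by decide) (positive₂_all (by decide)
      (positive₂_conj (List.forall_mem_map.2 fun i _ => ?_)))
    exact positive₂_or (positive₂_neq (h0 _) (h1 _)) (positive₂_iff (h0 _) (h1 _))
  · refine positive₂_conj (List.forall_mem_map.2 fun i _ => positive₂_all (by decide)
      (positive₂_ex (by decide) (positive₂_conj (List.forall_mem_map.2 fun j _ => ?_))))
    exact positive₂_iff (h1 _) (h0 _)

theorem positive₂_transfer {B : HornAtom ν} : Positive₂ (transfer B) := by
  refine positive₂_all (by decide) (positive₂_all (by decide) (positive₂_disj ?_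
    (List.forall_mem_map.2 fun k _ => ?_)))
  · exact positive₂_iff (positive₂_holds (by decide)) (positive₂_holds (by decide))
  · exact positive₂_neq (positive₂_reg (by decide)) (positive₂_reg (by decide))

theorem positive₂_clauseRule {C : HornClause ν} : Positive₂ (clauseRule C) := by
  refine positive₂_all (by decide) ?_
  induction C.body with
  | nil => exact positive₂_holds (by decide)
  | cons A l ih => exact positive₂_imp (positive₂_holds (by decide)) ih

theorem positive₂_ofProgram : Positive₂ (ofProgram P A) := by
  refine positive₂_imp (positive₂_and positive₂_registerAxioms (positive₂_and positive₂_transfer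
    (positive₂_conj (List.forall_mem_map.2 fun C _ => positive₂_and
      (positive₂_conj (List.forall_mem_map.2 fun _ _ => positive₂_transfer))
      positive₂_clauseRule)))) ?_
  exact positive₂_disj (positive₂_ex (by decide) (positive₂_holds (by decide)))
    (List.forall_mem_map.2 fun i _ => positive₂_ex (by decide) (positive₂_reg (by decide)))

end


/-! ### Partial recursive functions as Horn programs -/

open Nat.Partrec (Code)

/-- The relations used to evaluate partial recursive functions. The relations `lower` and `upper`
enumerate the graph of `Nat.pair` shell by shell: `lower a k c p` stands for
`a + c + 1 = k ∧ p = Nat.pair a k`, and `upper k b c p` for `b + c = k ∧ p = Nat.pair k b`. The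
relation `graph c` is the graph of `c.eval`, and `shift k` is the domain of the goal function
shifted by `k`. -/
inductive RelName : Type
  | lower
  | upper
  | pair
  | graph (c : Code)
  | shift (k : ℕ)

/-- The numbering of the relation names. It is explicit because the computability of the reduction
depends on the numbers of the relations `shift k`. -/
def RelName.index : RelName → ℕ
  | lower => 0
  | upper => 1
  | pair => 2
  | graph c => 2 * Encodable.encode c + 3
  | shift k => 2 * k + 4

theorem RelName.index_injective : Function.Injective RelName.index := by
  intro R S h
  cases R <;> cases S <;> simp only [index] at h <;> first | rfl | omega | skip
  · exact congrArg graph (Encodable.encode_injective (by omega))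
  · exact congrArg shift (by omega)

noncomputable instance : Encodable RelName := Encodable.ofInj _ RelName.index_injective

/-- The relation `R` applied to four terms. -/
def fact (R : RelName) (a b c d : Term) : HornAtom RelName := (R, ![a, b, c, d])

theorem vals_fact (e : Fin 8 → ℕ) (R : RelName) (a b c d : Term) :
    HornAtom.vals e (fact R a b c d) = ![a.val e, b.val e, c.val e, d.val e] := by
  funext k
  fin_cases k <;> rfl

@[simp]
theorem fact_fst (R : RelName) (a b c d : Term) : (fact R a b c d).1 = R := rfl

section
open Term RelName

/-- The clauses for the graph of `Nat.pair`. The shell with maximum `k` consists of the pairs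
`(a, k)` for `a < k`, followed by `(k, b)` for `b ≤ k`; `Nat.pair` numbers these consecutively, and the
third argument of `lower` and `upper` counts the steps that remain. -/
def pairClauses : List (HornClause RelName) :=
  [⟨fact upper none none none none, []⟩,
    ⟨fact lower (succ 0) (var 1) (var 2) (succ 3),
      [fact lower (var 0) (var 1) (succ 2) (var 3)]⟩,
    ⟨fact upper (var 1) none (var 1) (succ 3), [fact lower (var 0) (var 1) none (var 3)]⟩,
    ⟨fact upper (var 0) (succ 1) (var 2) (succ 3),
      [fact upper (var 0) (var 1) (succ 2) (var 3)]⟩,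
    ⟨fact lower none (succ 0) (var 0) (succ 3), [fact upper (var 0) (var 1) none (var 3)]⟩,
    ⟨fact pair (var 0) (var 1) (var 3) none, [fact lower (var 0) (var 1) (var 2) (var 3)]⟩,
    ⟨fact pair (var 0) (var 1) (var 3) none, [fact upper (var 0) (var 1) (var 2) (var 3)]⟩]

/-- The clauses that compute the graph of a code, with those of its subcodes. -/
def codeClauses : Code → List (HornClause RelName)
  | .zero => [⟨fact (graph .zero) (var 0) none none none, []⟩]
  | .succ => [⟨fact (graph .succ) (var 0) (succ 0) none none, []⟩]
  | .left => [⟨fact (graph .left) (var 2) (var 0) none none,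
      [fact pair (var 0) (var 1) (var 2) none]⟩]
  | .right => [⟨fact (graph .right) (var 2) (var 1) none none,
      [fact pair (var 0) (var 1) (var 2) none]⟩]
  | .pair f g =>
    ⟨fact (graph (.pair f g)) (var 0) (var 3) none none,
      [fact (graph f) (var 0) (var 1) none none, fact (graph g) (var 0) (var 2) none none,
        fact pair (var 1) (var 2) (var 3) none]⟩ ::
      (codeClauses f ++ codeClauses g)
  | .comp f g =>
    ⟨fact (graph (.comp f g)) (var 0) (var 2) none none,
      [fact (graph g) (var 0) (var 1) none none, fact (graph f) (var 1) (var 2) none none]⟩ ::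
      (codeClauses f ++ codeClauses g)
  | .prec f g =>
    ⟨fact (graph (.prec f g)) (var 2) (var 1) none none,
      [fact (graph f) (var 0) (var 1) none none, fact pair (var 0) none (var 2) none]⟩ ::
    ⟨fact (graph (.prec f g)) (var 7) (var 6) none none,
      [fact pair (var 0) (var 1) (var 2) none,
        fact (graph (.prec f g)) (var 2) (var 3) none none,
        fact pair (var 1) (var 3) (var 4) none, fact pair (var 0) (var 4) (var 5) none,
        fact (graph g) (var 5) (var 6) none none, fact pair (var 0) (succ 1) (var 7) none]⟩ ::
      (codeClauses f ++ codeClauses g)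
  | .rfind' f =>
    ⟨fact (graph (.rfind' f)) (var 2) (var 1) none none,
      [fact pair (var 0) (var 1) (var 2) none, fact (graph f) (var 2) none none none]⟩ ::
    ⟨fact (graph (.rfind' f)) (var 2) (var 5) none none,
      [fact pair (var 0) (var 1) (var 2) none, fact (graph f) (var 2) (succ 3) none none,
        fact pair (var 0) (succ 1) (var 4) none,
        fact (graph (.rfind' f)) (var 4) (var 5) none none]⟩ ::
      codeClauses f

/-- `shift (k + 1)` holds at `a` if `shift k` holds at `a + 1`. -/
def shiftClause (k : ℕ) : HornClause RelName :=
  ⟨fact (shift (k + 1)) (var 0) none none none, [fact (shift k) (succ 0) none none none]⟩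

/-- The program in which `shift n` holds at `0` if and only if the code `c` halts on `n`. -/
def haltProgram (c : Code) : ℕ → List (HornClause RelName)
  | 0 => ⟨fact (shift 0) (var 0) none none none, [fact (graph c) (var 0) (var 1) none none]⟩ ::
      (pairClauses ++ codeClauses c)
  | n + 1 => shiftClause n :: haltProgram c n

end

/-- A clause holds in a family of relations. -/
def HornClause.HoldsIn (M : RelName → (Fin 4 → ℕ) → Prop) (C : HornClause RelName) : Prop :=
  ∀ e : Fin 8 → ℕ, (∀ A ∈ C.body, M A.1 (HornAtom.vals e A)) →
    M C.head.1 (HornAtom.vals e C.head)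

theorem Derives.holdsIn {P : List (HornClause RelName)} {M : RelName → (Fin 4 → ℕ) → Prop}
    (hM : ∀ C ∈ P, C.HoldsIn M) {R : RelName} {v : Fin 4 → ℕ} (h : Derives P R v) : M R v := by
  induction h with
  | step C hC e _ ih => exact hM C hC e ih

/-- The intended meaning of the relations, where `c` is the goal function. -/
def intended (c : Code) : RelName → (Fin 4 → ℕ) → Prop
  | .lower, v => v 0 + v 2 + 1 = v 1 ∧ v 3 = Nat.pair (v 0) (v 1)
  | .upper, v => v 1 + v 2 = v 0 ∧ v 3 = Nat.pair (v 0) (v 1)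
  | .pair, v => v 2 = Nat.pair (v 0) (v 1)
  | .graph d, v => v 1 ∈ d.eval (v 0)
  | .shift k, v => (c.eval (v 0 + k)).Dom

/-- Unbounded search in terms of existing values, the form matched by the Horn clauses. -/
theorem mem_eval_rfind' {f : Code} {a m b : ℕ} :
    b ∈ (Code.rfind' f).eval (Nat.pair a m) ↔ ∃ n, n + m = b ∧ 0 ∈ f.eval (Nat.pair a (n + m)) ∧
      ∀ j < n, ∃ y, y + 1 ∈ f.eval (Nat.pair a (j + m)) := by
  simp only [Code.eval, Nat.unpaired, Nat.unpair_pair, Part.mem_map_iff, Part.map_eq_map]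
  refine exists_congr fun n => ?_
  rw [and_comm]
  refine and_congr Iff.rfl (Nat.mem_rfind.trans (and_congr ((Part.mem_map_iff _).trans ?_)
    (forall₂_congr fun j _ => (Part.mem_map_iff _).trans ?_)))
  · simp only [decide_eq_true_iff, exists_eq_right]
  constructor
  · rintro ⟨y, hy, h⟩
    obtain ⟨z, rfl⟩ := Nat.exists_eq_succ_of_ne_zero (by simpa using h)
    exact ⟨z, hy⟩
  · rintro ⟨y, hy⟩
    exact ⟨y + 1, hy, by simp⟩

theorem pair_of_lt {a b : ℕ} (h : a < b) : Nat.pair a b = b * b + a := if_pos h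

theorem pair_of_le {a b : ℕ} (h : b ≤ a) : Nat.pair a b = a * a + a + b := if_neg h.not_gt

theorem pairClauses_holdsIn (c : Code) : ∀ C ∈ pairClauses, C.HoldsIn (intended c) := by
  simp only [pairClauses, List.forall_mem_cons, HornClause.HoldsIn, vals_fact]
  refine ⟨?_, ?_, ?_, ?_, ?_, ?_, ?_, by simp⟩ <;> intro e <;>
    simp only [fact_fst, intended, Term.val, Matrix.cons_val]
  · exact fun _ => ⟨trivial, rfl⟩
  · rintro ⟨⟨h, h'⟩, -⟩
    rw [h', pair_of_lt (by omega), pair_of_lt (by omega)]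
    omega
  · rintro ⟨⟨h, h'⟩, -⟩
    rw [h', pair_of_lt (by omega), pair_of_le (by omega), ← h]
    exact ⟨by omega, by ring⟩
  · rintro ⟨⟨h, h'⟩, -⟩
    rw [h', pair_of_le (by omega), pair_of_le (by omega)]
    omega
  · rintro ⟨⟨h, h'⟩, -⟩
    rw [h', pair_of_le (by omega), pair_of_lt (by omega), ← h]
    exact ⟨by omega, by ring⟩
  · exact fun h => h.1.2
  · exact fun h => h.1.2

theorem codeClauses_holdsIn (c d : Code) : ∀ C ∈ codeClauses d, C.HoldsIn (intended c) := by
  induction d with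
  | zero =>
    refine List.forall_mem_singleton.2 fun e _ => ?_
    simp only [vals_fact, fact_fst, intended, Term.val, Matrix.cons_val]
    exact Part.mem_some _
  | succ =>
    refine List.forall_mem_singleton.2 fun e _ => ?_
    simp only [vals_fact, fact_fst, intended, Term.val, Matrix.cons_val]
    exact Part.mem_some _
  | left =>
    simp only [codeClauses, List.forall_mem_singleton, HornClause.HoldsIn, vals_fact]
    intro e h
    simp only [fact_fst, intended, Term.val, Matrix.cons_val] at h ⊢
    simp [Code.eval, h]
  | right =>
    simp only [codeClauses, List.forall_mem_singleton, HornClause.HoldsIn, vals_fact]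
    intro e h
    simp only [fact_fst, intended, Term.val, Matrix.cons_val] at h ⊢
    simp [Code.eval, h]
  | pair f g ihf ihg =>
    refine List.forall_mem_cons.2 ⟨fun e => ?_, List.forall_mem_append.2 ⟨ihf, ihg⟩⟩
    simp only [List.forall_mem_cons, vals_fact]
    simp only [fact_fst, intended, Term.val, Matrix.cons_val]
    rintro ⟨h₁, h₂, h₃, -⟩
    simp only [Code.eval, Seq.seq, Part.map_eq_map, Part.mem_bind_iff,
      Part.mem_map_iff]
    exact ⟨_, ⟨_, h₁, rfl⟩, _, h₂, h₃.symm⟩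
  | comp f g ihf ihg =>
    refine List.forall_mem_cons.2 ⟨fun e => ?_, List.forall_mem_append.2 ⟨ihf, ihg⟩⟩
    simp only [List.forall_mem_cons, vals_fact]
    simp only [fact_fst, intended, Term.val, Matrix.cons_val]
    rintro ⟨h₁, h₂, -⟩
    exact Part.mem_bind_iff.2 ⟨_, h₁, h₂⟩
  | prec f g ihf ihg =>
    refine List.forall_mem_cons.2 ⟨fun e => ?_, List.forall_mem_cons.2 ⟨fun e => ?_,
      List.forall_mem_append.2 ⟨ihf, ihg⟩⟩⟩
    · simp only [List.forall_mem_cons, vals_fact]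
      simp only [fact_fst, intended, Term.val, Matrix.cons_val]
      rintro ⟨h₁, h₂, -⟩
      rwa [h₂, Code.eval_prec_zero]
    · simp only [List.forall_mem_cons, vals_fact]
      simp only [fact_fst, intended, Term.val, Matrix.cons_val]
      rintro ⟨h₁, h₂, h₃, h₄, h₅, h₆, -⟩
      rw [h₆, Code.eval_prec_succ]
      rw [h₁] at h₂
      rw [h₄, h₃] at h₅
      exact Part.mem_bind_iff.2 ⟨_, h₂, h₅⟩
  | rfind' f ih =>
    refine List.forall_mem_cons.2 ⟨fun e => ?_, List.forall_mem_cons.2 ⟨fun e => ?_, ih⟩⟩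
    · simp only [List.forall_mem_cons, vals_fact]
      simp only [fact_fst, intended, Term.val, Matrix.cons_val]
      rintro ⟨h₁, h₂, -⟩
      rw [h₁] at h₂ ⊢
      exact mem_eval_rfind'.2 ⟨0, by simp, by simpa using h₂, by simp⟩
    · simp only [List.forall_mem_cons, vals_fact]
      simp only [fact_fst, intended, Term.val, Matrix.cons_val]
      rintro ⟨h₁, h₂, h₃, h₄, -⟩
      rw [h₃] at h₄
      rw [h₁] at h₂ ⊢
      obtain ⟨n, hn, h0, hpos⟩ := mem_eval_rfind'.1 h₄
      refine mem_eval_rfind'.2 ⟨n + 1, by omega, ?_, ?_⟩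
      · rwa [show n + 1 + e 1 = n + (e 1 + 1) by omega]
      · intro j hj
        rcases j with _ | j
        · exact ⟨_, by rwa [Nat.zero_add]⟩
        · rw [show j + 1 + e 1 = j + (e 1 + 1) by omega]
          exact hpos j (by omega)

theorem haltProgram_holdsIn (c : Code) (n : ℕ) :
    ∀ C ∈ haltProgram c n, C.HoldsIn (intended c) := by
  induction n with
  | zero =>
    refine List.forall_mem_cons.2 ⟨fun e => ?_, List.forall_mem_append.2
      ⟨pairClauses_holdsIn c, codeClauses_holdsIn c c⟩⟩
    simp only [List.forall_mem_cons, vals_fact]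
    simp only [fact_fst, intended, Term.val, Matrix.cons_val]
    exact fun h => Part.dom_iff_mem.2 ⟨_, h.1⟩
  | succ n ih =>
    refine List.forall_mem_cons.2 ⟨fun e => ?_, ih⟩
    simp only [shiftClause, List.forall_mem_cons, vals_fact]
    simp only [fact_fst, intended, Term.val, Matrix.cons_val]
    rintro ⟨h, -⟩
    rwa [add_right_comm] at h

section
variable {P : List (HornClause RelName)}

theorem Derives.of_mem {C : HornClause RelName} (hC : C ∈ P) (e : Fin 8 → ℕ) {R : RelName}
    {v : Fin 4 → ℕ} (hR : C.head.1 = R) (hv : HornAtom.vals e C.head = v)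
    (h : ∀ A ∈ C.body, Derives P A.1 (HornAtom.vals e A)) : Derives P R v := by
  subst hR hv
  exact .step C hC e h

/-- Every pair is reached by the enumeration by shells. -/
theorem derives_pair (hP : pairClauses ⊆ P) (a b : ℕ) :
    Derives P .pair ![a, b, Nat.pair a b, 0] := by
  simp only [pairClauses, List.cons_subset] at hP
  obtain ⟨h₀, h₁, h₂, h₃, h₄, h₅, h₆, -⟩ := hP
  have hlower : ∀ k, Derives P .lower ![0, k + 1, k, (k + 1) * (k + 1)] →
      ∀ a c, a + c = k → Derives P .lower ![a, k + 1, c, (k + 1) * (k + 1) + a] := by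
    intro k hk a
    induction a with
    | zero =>
      rintro c rfl
      simpa using hk
    | succ a ih =>
      rintro c h
      refine .of_mem h₁ ![a, k + 1, c, (k + 1) * (k + 1) + a, 0, 0, 0, 0] rfl
        (by simp [vals_fact, Term.val, add_assoc]) ?_
      have := ih (c + 1) (by omega)
      simpa [vals_fact, Term.val] using this
  have hupper : ∀ k, Derives P .upper ![k, 0, k, k * k + k] →
      ∀ b c, b + c = k → Derives P .upper ![k, b, c, k * k + k + b] := by
    intro k hk b
    induction b with
    | zero =>
      rintro c rfl
      simpa using hk
    | succ b ih =>
      rintro c h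
      refine .of_mem h₃ ![k, b, c, k * k + k + b, 0, 0, 0, 0] rfl
        (by simp [vals_fact, Term.val, add_assoc]) ?_
      have := ih (c + 1) (by omega)
      simpa [vals_fact, Term.val] using this
  have hstart : ∀ k, Derives P .upper ![k, 0, k, k * k + k] := by
    intro k
    induction k with
    | zero => exact .of_mem h₀ 0 rfl (by simp [vals_fact, Term.val]) (by simp)
    | succ k ih =>
      have hl : Derives P .lower ![0, k + 1, k, (k + 1) * (k + 1)] := by
        refine .of_mem h₄ ![k, k, 0, k * k + k + k, 0, 0, 0, 0] rfl ?_ ?_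
        · simp only [vals_fact, Term.val, Matrix.cons_val]
          congr 4
          ring
        · simpa [vals_fact, Term.val] using hupper k ih k 0 rfl
      refine .of_mem h₂ ![k, k + 1, 0, (k + 1) * (k + 1) + k, 0, 0, 0, 0] rfl
        (by simp [vals_fact, Term.val, add_assoc]) ?_
      simpa [vals_fact, Term.val] using hlower k hl k 0 rfl
  rcases lt_or_ge a b with h | h
  · rw [pair_of_lt h]
    obtain ⟨k, rfl⟩ := Nat.exists_eq_succ_of_ne_zero (by omega : b ≠ 0)
    have hl : Derives P .lower ![0, k + 1, k, (k + 1) * (k + 1)] := by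
      refine .of_mem h₄ ![k, k, 0, k * k + k + k, 0, 0, 0, 0] rfl ?_ ?_
      · simp only [vals_fact, Term.val, Matrix.cons_val]
        congr 4
        ring
      · simpa [vals_fact, Term.val] using hupper k (hstart k) k 0 rfl
    refine .of_mem h₅ ![a, k + 1, k - a, (k + 1) * (k + 1) + a, 0, 0, 0, 0] rfl
      (by simp [vals_fact, Term.val]) ?_
    simpa [vals_fact, Term.val] using hlower k hl a (k - a) (by omega)
  · rw [pair_of_le h]
    refine .of_mem h₆ ![a, b, a - b, a * a + a + b, 0, 0, 0, 0] rfl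
      (by simp [vals_fact, Term.val]) ?_
    simpa [vals_fact, Term.val] using hupper a (hstart a) b (a - b) (by omega)

theorem derives_graph (hP : pairClauses ⊆ P) (c : Code) (hc : codeClauses c ⊆ P) :
    ∀ {a b : ℕ}, b ∈ c.eval a → Derives P (.graph c) ![a, b, 0, 0] := by
  have hpair := derives_pair hP
  induction c with
  | zero =>
    intro a b h
    obtain rfl : b = 0 := Part.mem_some_iff.1 h
    exact .of_mem (hc List.mem_cons_self) (fun _ => a) rfl (by simp [vals_fact, Term.val])
      (by simp)
  | succ =>
    intro a b h
    obtain rfl : b = a + 1 := by simpa [Code.eval] using h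
    exact .of_mem (hc List.mem_cons_self) (fun _ => a) rfl (by simp [vals_fact, Term.val])
      (by simp)
  | left =>
    intro a b h
    obtain rfl : b = a.unpair.1 := by simpa [Code.eval] using h
    refine .of_mem (hc List.mem_cons_self) ![a.unpair.1, a.unpair.2, a, 0, 0, 0, 0, 0] rfl
      (by simp [vals_fact, Term.val]) ?_
    simpa [vals_fact, Term.val] using hpair a.unpair.1 a.unpair.2
  | right =>
    intro a b h
    obtain rfl : b = a.unpair.2 := by simpa [Code.eval] using h
    refine .of_mem (hc List.mem_cons_self) ![a.unpair.1, a.unpair.2, a, 0, 0, 0, 0, 0] rfl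
      (by simp [vals_fact, Term.val]) ?_
    simpa [vals_fact, Term.val] using hpair a.unpair.1 a.unpair.2
  | pair f g ihf ihg =>
    intro a b h
    rw [codeClauses, List.cons_subset, List.append_subset] at hc
    simp only [Code.eval, Seq.seq, Part.map_eq_map, Part.mem_bind_iff,
      Part.mem_map_iff] at h
    obtain ⟨_, ⟨x, hx, rfl⟩, y, hy, rfl⟩ := h
    refine .of_mem hc.1 ![a, x, y, Nat.pair x y, 0, 0, 0, 0] rfl
      (by simp [vals_fact, Term.val]) ?_
    simp only [List.forall_mem_cons, vals_fact]
    exact ⟨ihf hc.2.1 hx, ihg hc.2.2 hy, hpair x y, by simp⟩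
  | comp f g ihf ihg =>
    intro a b h
    rw [codeClauses, List.cons_subset, List.append_subset] at hc
    obtain ⟨x, hx, hb⟩ := Part.mem_bind_iff.1 h
    refine .of_mem hc.1 ![a, x, b, 0, 0, 0, 0, 0] rfl (by simp [vals_fact, Term.val]) ?_
    simp only [List.forall_mem_cons, vals_fact]
    exact ⟨ihg hc.2.2 hx, ihf hc.2.1 hb, by simp⟩
  | prec f g ihf ihg =>
    rw [codeClauses, List.cons_subset, List.cons_subset, List.append_subset] at hc
    intro a b h
    obtain ⟨x, n, rfl⟩ : ∃ x n, a = Nat.pair x n := ⟨_, _, (Nat.pair_unpair a).symm⟩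
    induction n generalizing b with
    | zero =>
      rw [Code.eval_prec_zero] at h
      refine .of_mem hc.1 ![x, b, Nat.pair x 0, 0, 0, 0, 0, 0] rfl
        (by simp [vals_fact, Term.val]) ?_
      simp only [List.forall_mem_cons, vals_fact]
      exact ⟨ihf hc.2.2.1 h, hpair x 0, by simp⟩
    | succ n ih =>
      rw [Code.eval_prec_succ] at h
      obtain ⟨i, hi, hb⟩ := Part.mem_bind_iff.1 h
      refine .of_mem hc.2.1 ![x, n, Nat.pair x n, i, Nat.pair n i, Nat.pair x (Nat.pair n i), b,
        Nat.pair x (n + 1)] rfl (by simp [vals_fact, Term.val]) ?_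
      simp only [List.forall_mem_cons, vals_fact]
      exact ⟨hpair x n, ih hi, hpair n i, hpair x _, ihg hc.2.2.2 hb, hpair x (n + 1), by simp⟩
  | rfind' f ih =>
    rw [codeClauses, List.cons_subset, List.cons_subset] at hc
    intro a b h
    obtain ⟨x, m, rfl⟩ : ∃ x m, a = Nat.pair x m := ⟨_, _, (Nat.pair_unpair a).symm⟩
    obtain ⟨n, rfl, h0, hpos⟩ := mem_eval_rfind'.1 h
    clear h
    induction n generalizing m with
    | zero =>
      rw [Nat.zero_add] at h0 ⊢
      refine .of_mem hc.1 ![x, m, Nat.pair x m, 0, 0, 0, 0, 0] rfl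
        (by simp [vals_fact, Term.val]) ?_
      simp only [List.forall_mem_cons, vals_fact]
      exact ⟨hpair x m, ih hc.2.2 h0, by simp⟩
    | succ n ihn =>
      have hn : n + 1 + m = n + (m + 1) := by omega
      rw [hn] at h0 ⊢
      obtain ⟨y, hy⟩ := hpos 0 (Nat.succ_pos n)
      rw [Nat.zero_add] at hy
      refine .of_mem hc.2.1 ![x, m, Nat.pair x m, y, Nat.pair x (m + 1), n + (m + 1), 0, 0] rfl
        (by simp [vals_fact, Term.val]) ?_
      simp only [List.forall_mem_cons, vals_fact]
      refine ⟨hpair x m, ih hc.2.2 hy, hpair x (m + 1), ihn (m + 1) h0 fun j hj => ?_, by simp⟩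
      rw [show j + (m + 1) = j + 1 + m by omega]
      exact hpos (j + 1) (by omega)

theorem derives_shift (c : Code) (n : ℕ) :
    ∀ m, (c.eval (m + n)).Dom → Derives (haltProgram c n) (.shift n) ![m, 0, 0, 0] := by
  -- Adding clauses preserves derivability, so the statement is generalized to larger programs.
  suffices H : ∀ (P : List (HornClause RelName)), haltProgram c n ⊆ P →
      ∀ m, (c.eval (m + n)).Dom → Derives P (.shift n) ![m, 0, 0, 0] from
    H _ (List.Subset.refl _)
  intro P
  induction n with
  | zero =>
    intro hP m hm
    rw [haltProgram, List.cons_subset, List.append_subset] at hP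
    obtain ⟨b, hb⟩ := Part.dom_iff_mem.1 hm
    refine .of_mem hP.1 ![m, b, 0, 0, 0, 0, 0, 0] rfl (by simp [vals_fact, Term.val]) ?_
    simp only [List.forall_mem_cons, vals_fact]
    exact ⟨derives_graph hP.2.1 c hP.2.2 hb, by simp⟩
  | succ n ih =>
    intro hP m hm
    rw [haltProgram, List.cons_subset] at hP
    refine .of_mem hP.1 (fun _ => m) rfl (by simp [shiftClause, vals_fact, Term.val]) ?_
    simp only [shiftClause, List.forall_mem_cons, vals_fact]
    exact ⟨ih hP.2 (m + 1) (by rwa [add_right_comm]), by simp⟩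

end

/-- The goal `shift n` at `0`. -/
def haltGoal (n : ℕ) : HornAtom RelName := fact (.shift n) none none none none

theorem derives_haltGoal_iff (c : Code) (n : ℕ) :
    (∃ e, Derives (haltProgram c n) (haltGoal n).1 (HornAtom.vals e (haltGoal n))) ↔
      (c.eval n).Dom := by
  constructor
  · rintro ⟨e, h⟩
    have := h.holdsIn (haltProgram_holdsIn c n)
    simpa [haltGoal, vals_fact, intended, Term.val] using this
  · intro h
    refine ⟨0, ?_⟩
    rw [haltGoal, vals_fact]
    exact derives_shift c n 0 (by simpa using h)


/-! ### Computability of the reduction -/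

section
variable {F G : ℕ → Formula}

theorem primrec_code_and (hF : Primrec fun n => (F n).code) (hG : Primrec fun n => (G n).code) :
    Primrec fun n => ((F n).and (G n)).code :=
  Primrec₂.natPair.comp (Primrec.const 2) (Primrec₂.natPair.comp hF hG)

theorem primrec_code_or (hF : Primrec fun n => (F n).code) (hG : Primrec fun n => (G n).code) :
    Primrec fun n => ((F n).or (G n)).code :=
  Primrec₂.natPair.comp (Primrec.const 3) (Primrec₂.natPair.comp hF hG)

theorem primrec_code_imp (hF : Primrec fun n => (F n).code) (hG : Primrec fun n => (G n).code) :
    Primrec fun n => ((F n).imp (G n)).code :=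
  Primrec₂.natPair.comp (Primrec.const 4) (Primrec₂.natPair.comp hF hG)

theorem primrec_code_all (x : ℕ) (hF : Primrec fun n => (F n).code) :
    Primrec fun n => (all x (F n)).code :=
  Primrec₂.natPair.comp (Primrec.const 5) (Primrec₂.natPair.comp (Primrec.const x) hF)

theorem primrec_code_ex (x : ℕ) (hF : Primrec fun n => (F n).code) :
    Primrec fun n => (ex x (F n)).code :=
  Primrec₂.natPair.comp (Primrec.const 6) (Primrec₂.natPair.comp (Primrec.const x) hF)

theorem primrec_code_disj_map {ι : Type} {l : List ι} {H : ι → ℕ → Formula}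
    (hF : Primrec fun n => (F n).code) (hH : ∀ i, Primrec fun n => (H i n).code) :
    Primrec fun n => (disj (F n) (l.map fun i => H i n)).code := by
  induction l with
  | nil => exact hF
  | cons i l ih => exact primrec_code_or (hH i) ih

theorem primrec_code_iff (hF : Primrec fun n => (F n).code) (hG : Primrec fun n => (G n).code) :
    Primrec fun n => (iff (F n) (G n)).code :=
  primrec_code_and (primrec_code_imp hF hG) (primrec_code_imp hG hF)

end

/-- The letter for the relation `shift (n + i)` is a primitive recursive function of `n`. -/
theorem primrec_code_holds_shift (i : ℕ) (args : Fin 4 → Term) (x : ℕ) :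
    Primrec fun n => (holds (RelName.shift (n + i), args) x).code := by
  have h : ∀ n, (holds (RelName.shift (n + i), args) x).code =
      Nat.pair 0 (Nat.pair 1 (Nat.pair
        (2 * Nat.pair (2 * (n + i) + 4) (Encodable.encode args) + 1)
        (Encodable.encode (List.ofFn fun _ : Fin 1 => x)))) := fun _ => rfl
  simp only [h]
  refine Primrec₂.natPair.comp (.const _) (Primrec₂.natPair.comp (.const _)
    (Primrec₂.natPair.comp ?_ (.const _)))
  refine Primrec.nat_add.comp (Primrec.nat_mul.comp (.const _) (Primrec₂.natPair.comp ?_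
    (.const _))) (.const _)
  exact Primrec.nat_add.comp (Primrec.nat_mul.comp (.const _)
    (Primrec.nat_add.comp .id (.const _))) (.const _)

theorem primrec_code_transfer_shift (i : ℕ) (args : Fin 4 → Term) :
    Primrec fun n => (transfer (RelName.shift (n + i), args)).code :=
  primrec_code_all 0 (primrec_code_all 1 (primrec_code_disj_map
    (primrec_code_iff (primrec_code_holds_shift i args 0)
      (primrec_code_holds_shift i stdArgs 1)) fun k =>
      .const (neq (reg (args k) 0) (reg (stdArgs k) 1)).code))

theorem primrec_code_ofClause_shiftClause :
    Primrec fun n => (ofClause (shiftClause n)).code :=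
  primrec_code_and
    (primrec_code_and (primrec_code_transfer_shift 1 _)
      (primrec_code_and (primrec_code_transfer_shift 0 _) (.const _)))
    (primrec_code_all 0 (primrec_code_imp (primrec_code_holds_shift 0 _ 0)
      (primrec_code_holds_shift 1 _ 0)))

theorem primrec_code_haltProgram (c : Code) :
    Primrec fun n => (conj ((haltProgram c n).map ofClause)).code := by
  refine (Primrec.nat_rec₁ (f := fun n m => Nat.pair 2 (Nat.pair (ofClause (shiftClause n)).code m))
    (conj ((haltProgram c 0).map ofClause)).code ?_).of_eq fun n => ?_
  · exact Primrec₂.natPair.comp (.const _) (Primrec₂.natPair.comp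
      (primrec_code_ofClause_shiftClause.comp .fst) .snd)
  · induction n with
    | zero => rfl
    | succ n ih =>
      simp only [ih]
      rfl

theorem primrec_code_ofProgram_haltProgram (c : Code) :
    Primrec fun n => (ofProgram (haltProgram c n) (haltGoal n)).code :=
  primrec_code_imp
    (primrec_code_and (.const _) (primrec_code_and (primrec_code_transfer_shift 0 _)
      (primrec_code_haltProgram c)))
    (primrec_code_disj_map (primrec_code_ex 0 (primrec_code_holds_shift 0 _ 0)) fun _ => .const _)

theorem exists_code_eval_dom_iff {A : ℕ → Prop} (hA : REPred A) :
    ∃ c : Code, ∀ n, A n ↔ (c.eval n).Dom := by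
  obtain ⟨c, hc⟩ := Code.exists_code.1 hA
  refine ⟨c, fun n => ?_⟩
  rw [hc]
  simp [Part.assert]

end PredKripke

theorem theorem4 (L : Set PredKripke.Formula)
    (hQLC : PredKripke.QLC ⊆ L)
    (hNat : L ⊆ PredKripke.QSIL {PredKripke.natConst}) :
    PredKripke.Sigma01HardIn {φ | φ.IsPositive ∧ φ.InTwoVarLang}
      (PredKripke.positiveFragment L) := by
  intro A hA
  obtain ⟨c, hc⟩ := PredKripke.exists_code_eval_dom_iff hA
  refine ⟨fun n => PredKripke.Formula.ofProgram (PredKripke.haltProgram c n)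
    (PredKripke.haltGoal n), (PredKripke.primrec_code_ofProgram_haltProgram c).to_comp,
    fun n => PredKripke.positive₂_ofProgram, fun n => ?_⟩
  rw [hc, ← PredKripke.derives_haltGoal_iff]
  constructor
  · intro h
    exact ⟨hQLC fun F _ => PredKripke.validates_ofProgram h F, PredKripke.positive₂_ofProgram.1⟩
  · intro h
    exact PredKripke.derives_of_natConst_validates (hNat h.1 PredKripke.natConst rfl)
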